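/- Let $\Omega$ be a first-order signature containing a functional symbol of arity at least $2$, and let $\mathcal C$ be the class of all models of $\Omega$ (nonempty $\Omega$-structures). Write $\mathfrak A\sqsupseteq\mathfrak B$ if $\mathfrak A$ contains $\mathfrak B$ as a submodel. Let $L$ be a model-theoretic language based on $\Omega$: a collection $L_s$ of sentences with a satisfaction relation $\vDash$ between models of $\Omega$ and sentences which is preserved under isomorphisms, such that $L$ includes first-order logic $L_{\omega,\omega}$ (with equality) over $\Omega$ and $L_s$ is closed under the Boolean connectives. Assume that $L$ expresses the $\sqsupseteq$-satisfiability on $\mathcal C$, i.e., that there is $f:L_s\to L_s$ such that for all $\varphi\in L_s$ and $\mathfrak A\in\mathcal C$, $$\mathfrak A\vDash f(\varphi)\iff\exists\,\mathfrak B\in\mathcal C\ (\mathfrak A\sqsupseteq\mathfrak B\ \text{ and }\ \mathfrak B\vDash\varphi).$$ Modal formulas are built from countably many propositional variables by $\bot,\to,\Diamond$, with $\Box=\neg\Diamond\neg$. The modal theory $\mathrm{MTh}^L(\mathcal C,\sqsupseteq)$ is the set of all modal formulas $\alpha$ such that $[\alpha]$ holds in every model in $\mathcal C$ for every map $[\,\cdot\,]$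 from propositional variables to $L_s$, extended to modal formulas by $[\bot]=\bot$, $[\alpha\to\beta]=[\alpha]\to[\beta]$, $[\Diamond\alpha]=f([\alpha])$ (it does not depend on the choice of such an $f$). Then $$\mathrm{MTh}^L(\mathcal C,\sqsupseteq)=\begin{cases}\mathrm{S4}&\text{if $\Omega$ has no constant symbols},\\ \mathrm{S4.2.1}&\text{otherwise.}\end{cases}$$ Here a normal modal logic is a set of modal formulas that contains all classical tautologies, $\neg\Diamond\bot$ and $\Diamond(p\vee q)\to\Diamond p\vee\Diamond q$, and is closed under modus ponens, substitution, and monotonicity (from $\alpha\to\beta$ infer $\Diamond\alpha\to\Diamond\beta$); $\mathrm{S4}$ is the smallest normal modal logic containing $\Diamond\Diamond p\to\Diamond p$ and $p\to\Diamond p$; and $\mathrm{S4.2.1}$ is the smallest normal modal logic that includes $\mathrm{S4}$ and contains $\Box\Diamond p\leftrightarrow\Diamond\Box p$. -/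

import Mathlib

/-! Modal theories of relations between models: modal logics, model-theoretic languages, and the
submodel relation. -/

universe u v w s

/-- Propositional modal formulas over the countable set `ℕ` of variables, with basic connectives
`⊥`, `→`, `◇`. -/
inductive ModalFormula : Type where
  | var : ℕ → ModalFormula
  | bot : ModalFormula
  | imp : ModalFormula → ModalFormula → ModalFormula
  | dia : ModalFormula → ModalFormula

namespace ModalFormula

def neg (a : ModalFormula) : ModalFormula := imp a bot

def or (a b : ModalFormula) : ModalFormula := imp (neg a) b

def and (a b : ModalFormula) : ModalFormula := neg (imp a (neg b))

def iff (a b : ModalFormula) : ModalFormula := and (imp a b) (imp b a)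

def box (a : ModalFormula) : ModalFormula := neg (dia (neg a))

/-- Uniform substitution of formulas for variables. -/
def subst (σ : ℕ → ModalFormula) : ModalFormula → ModalFormula
  | var n => σ n
  | bot => bot
  | imp a b => imp (subst σ a) (subst σ b)
  | dia a => dia (subst σ a)

/-- Classical tautologies: true under every assignment of truth values that respects `⊥` and `→`
(formulas `◇ a` count as atoms). -/
def IsTautology (a : ModalFormula) : Prop :=
  ∀ v : ModalFormula → Prop, ¬ v bot → (∀ b c, v (imp b c) ↔ (v b → v c)) → v a

end ModalFormula

open ModalFormula in
/-- Normal (propositional, unimodal) logics. -/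
structure IsNormalLogic (Λ : Set ModalFormula) : Prop where
  tautology : ∀ a, IsTautology a → a ∈ Λ
  dia_bot : neg (dia bot) ∈ Λ
  dia_or : imp (dia (or (var 0) (var 1))) (or (dia (var 0)) (dia (var 1))) ∈ Λ
  modus_ponens : ∀ a b, a ∈ Λ → imp a b ∈ Λ → b ∈ Λ
  substitution : ∀ a, a ∈ Λ → ∀ σ : ℕ → ModalFormula, subst σ a ∈ Λ
  monotonicity : ∀ a b, imp a b ∈ Λ → imp (dia a) (dia b) ∈ Λ

/-- The smallest normal logic that includes `Γ`. -/
def leastNormalLogic (Γ : Set ModalFormula) : Set ModalFormula :=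
  ⋂₀ {Λ | IsNormalLogic Λ ∧ Γ ⊆ Λ}

open ModalFormula in
/-- `S4`: the smallest normal logic containing `◇◇p → ◇p` and `p → ◇p`. -/
def logicS4 : Set ModalFormula :=
  leastNormalLogic {imp (dia (dia (var 0))) (dia (var 0)), imp (var 0) (dia (var 0))}

open ModalFormula in
/-- `S4.2.1 = S4 + (□◇p ↔ ◇□p)`. -/
def logicS421 : Set ModalFormula :=
  leastNormalLogic (logicS4 ∪ {iff (box (dia (var 0))) (dia (box (var 0)))})

open FirstOrder in
/-- The models of the signature `Ω` (with universe in `Type w`): nonempty `Ω`-structures. -/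
abbrev SigModel (Ω : FirstOrder.Language.{u, v}) : Type (max u v (w + 1)) :=
  FirstOrder.Language.Theory.ModelType.{u, v, w} (∅ : Ω.Theory)

open FirstOrder in
/-- A model-theoretic language `L = L(Ω)` based on the signature `Ω`, given by its sentences and its
satisfaction relation: satisfaction is preserved under isomorphisms, `L` includes first-order logic
(with equality), and the sentences of `L` are closed under implication, hence, together with the
first-order `⊥`, under all Boolean connectives. -/
structure ModelTheoreticLanguage (Ω : FirstOrder.Language.{u, v}) where
  Sent : Type s
  Sat : SigModel.{u, v, w} Ω → Sent → Prop
  sat_of_equiv : ∀ (A B : SigModel.{u, v, w} Ω), (A ≃[Ω] B) → ∀ φ : Sent, Sat A φ → Sat B φ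
  ofFirstOrder : Ω.Sentence → Sent
  sat_ofFirstOrder : ∀ (A : SigModel.{u, v, w} Ω) (φ : Ω.Sentence), Sat A (ofFirstOrder φ) ↔ A ⊨ φ
  imp : Sent → Sent → Sent
  sat_imp : ∀ (A : SigModel.{u, v, w} Ω) (φ ψ : Sent), Sat A (imp φ ψ) ↔ (Sat A φ → Sat A ψ)

namespace ModelTheoreticLanguage

/-- The sentence `⊥` of `L`. -/
def bot {Ω : FirstOrder.Language.{u, v}} (L : ModelTheoreticLanguage.{u, v, w, s} Ω) : L.Sent :=
  L.ofFirstOrder ⊥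

/-- The `L`-theory of a class of models. -/
def theoryOf {Ω : FirstOrder.Language.{u, v}} (L : ModelTheoreticLanguage.{u, v, w, s} Ω)
    (C : Set (SigModel.{u, v, w} Ω)) : Set L.Sent :=
  {φ | ∀ A ∈ C, L.Sat A φ}

/-- The extension to all modal formulas of a valuation of the variables in the sentences of `L`,
where `◇` is interpreted by the operation `f` on sentences. -/
def extend {Ω : FirstOrder.Language.{u, v}} (L : ModelTheoreticLanguage.{u, v, w, s} Ω)
    (f : L.Sent → L.Sent) (θ : ℕ → L.Sent) : ModalFormula → L.Sent
  | .var n => θ n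
  | .bot => L.bot
  | .imp a b => L.imp (L.extend f θ a) (L.extend f θ b)
  | .dia a => f (L.extend f θ a)

/-- The modal theory `MTh(T, f)` of the operation `f` on the set of sentences `T`. -/
def modalTheory {Ω : FirstOrder.Language.{u, v}} (L : ModelTheoreticLanguage.{u, v, w, s} Ω)
    (T : Set L.Sent) (f : L.Sent → L.Sent) : Set ModalFormula :=
  {a | ∀ θ : ℕ → L.Sent, L.extend f θ a ∈ T}

/-- The operation `f` expresses the `R`-satisfiability on the class `C`. -/
def Expresses {Ω : FirstOrder.Language.{u, v}} (L : ModelTheoreticLanguage.{u, v, w, s} Ω)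
    (f : L.Sent → L.Sent) (C : Set (SigModel.{u, v, w} Ω))
    (R : SigModel.{u, v, w} Ω → SigModel.{u, v, w} Ω → Prop) : Prop :=
  ∀ (φ : L.Sent), ∀ A ∈ C, (L.Sat A (f φ) ↔ ∃ B ∈ C, R A B ∧ L.Sat B φ)

end ModelTheoreticLanguage

open FirstOrder in
/-- `A ⊒ B`: the model `A` contains `B` as a submodel. Universes of models are types, so `B` is
identified with a substructure of `A` along an isomorphism. -/
def ContainsSubmodel {Ω : FirstOrder.Language.{u, v}} (A B : SigModel.{u, v, w} Ω) : Prop :=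
  ∃ S : Ω.Substructure A, Nonempty (B ≃[Ω] S)

/-! Soundness: embeddability is reflexive and transitive, which yields S4. If there are constants,
they generate a least submodel of every model; it has no proper submodels, so `□◇p` and `◇□p` both
say that `p` holds there.

Completeness: a formula outside the logic fails at a maximal consistent set `m`, and the worlds
reachable from `m` unravel to a tree indexed by finite lists (`IsWorld.exists_tree`). One structure
realises the whole tree: the symbols of arity at least 2 act as a multiplication on lists whose
nonempty closed sets are exactly the cones (`exists_cone`), and it is built so that first-order
sentences read the labels of the root of a cone (`rootProperty_iff`). Constants denote an extra
neutral element `none`. If they exist, `{none}` is the least submodel and plays the greatest world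
(`finalWorld`) that S4.2.1 provides; if not, the cone models omit `none`. By the truth lemma
`sat_extend_treeValuation` the cone of `x` satisfies the translation of `a` iff `a` lies in the
world at `x`. The valuation is first-order, so the strength of `L` plays no role. -/

open ModalFormula

/-! ### Normal logics and their maximal consistent worlds -/

theorem leastNormalLogic_isNormalLogic (Γ : Set ModalFormula) :
    IsNormalLogic (leastNormalLogic Γ) where
  tautology a ha := fun _ hΛ => hΛ.1.tautology a ha
  dia_bot := fun _ hΛ => hΛ.1.dia_bot
  dia_or := fun _ hΛ => hΛ.1.dia_or
  modus_ponens a b ha hab := fun Λ hΛ => hΛ.1.modus_ponens a b (ha Λ hΛ) (hab Λ hΛ)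
  substitution a ha σ := fun Λ hΛ => hΛ.1.substitution a (ha Λ hΛ) σ
  monotonicity a b hab := fun Λ hΛ => hΛ.1.monotonicity a b (hab Λ hΛ)

theorem subset_leastNormalLogic (Γ : Set ModalFormula) : Γ ⊆ leastNormalLogic Γ :=
  fun _ ha _ hΛ => hΛ.2 ha

theorem leastNormalLogic_subset {Γ Λ : Set ModalFormula} (hΛ : IsNormalLogic Λ) (h : Γ ⊆ Λ) :
    leastNormalLogic Γ ⊆ Λ :=
  fun _ ha => ha Λ ⟨hΛ, h⟩

/-- The normal logics that contain all instances of `◇◇p → ◇p` and `p → ◇p`. -/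
structure IsS4Logic (Λ : Set ModalFormula) : Prop extends IsNormalLogic Λ where
  trans : ∀ a, imp (dia (dia a)) (dia a) ∈ Λ
  refl : ∀ a, imp a (dia a) ∈ Λ

theorem isS4Logic_of_mem {Λ : Set ModalFormula} (hΛ : IsNormalLogic Λ)
    (h4 : imp (dia (dia (var 0))) (dia (var 0)) ∈ Λ) (hT : imp (var 0) (dia (var 0)) ∈ Λ) :
    IsS4Logic Λ where
  toIsNormalLogic := hΛ
  trans a := hΛ.substitution _ h4 fun _ => a
  refl a := hΛ.substitution _ hT fun _ => a

theorem logicS4_isS4Logic : IsS4Logic logicS4 :=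
  isS4Logic_of_mem (leastNormalLogic_isNormalLogic _)
    (subset_leastNormalLogic _ (by simp)) (subset_leastNormalLogic _ (by simp))

theorem logicS4_subset_logicS421 : logicS4 ⊆ logicS421 :=
  Set.subset_union_left.trans (subset_leastNormalLogic _)

theorem logicS421_isS4Logic : IsS4Logic logicS421 :=
  isS4Logic_of_mem (leastNormalLogic_isNormalLogic _)
    (logicS4_subset_logicS421 (subset_leastNormalLogic _ (by simp)))
    (logicS4_subset_logicS421 (subset_leastNormalLogic _ (by simp)))

theorem box_dia_iff_mem_logicS421 (a : ModalFormula) :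
    iff (box (dia a)) (dia (box a)) ∈ logicS421 :=
  (leastNormalLogic_isNormalLogic _).substitution (iff (box (dia (var 0))) (dia (box (var 0))))
    (subset_leastNormalLogic _ (Or.inr (Set.mem_singleton _))) fun _ => a

/-- The sets of formulas that include `Λ` and are closed under modus ponens. -/
structure IsModalTheory (Λ T : Set ModalFormula) : Prop where
  subset : Λ ⊆ T
  modus_ponens : ∀ a b, a ∈ T → imp a b ∈ T → b ∈ T

/-- The maximal consistent sets of a logic `Λ`. -/
structure IsWorld (Λ m : Set ModalFormula) : Prop where
  subset : Λ ⊆ m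
  bot_notMem : bot ∉ m
  imp_mem : ∀ b c, imp b c ∈ m ↔ (b ∈ m → c ∈ m)

/-- Every formula of `n` is possible in `m`. -/
def Sees (m n : Set ModalFormula) : Prop := ∀ a ∈ n, dia a ∈ m

variable {Λ m n T : Set ModalFormula} {a b c : ModalFormula}

theorem IsModalTheory.mem_of_tautology (hΛ : IsNormalLogic Λ) (hT : IsModalTheory Λ T)
    (h : IsTautology a) : a ∈ T :=
  hT.subset (hΛ.tautology a h)

theorem IsModalTheory.adjoin (hΛ : IsNormalLogic Λ) (hT : IsModalTheory Λ T)
    (b : ModalFormula) : IsModalTheory Λ {c | imp b c ∈ T} where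
  subset c hc := hT.modus_ponens c _ (hT.subset hc)
    (hT.mem_of_tautology hΛ fun v _ h => by simp only [h]; tauto)
  modus_ponens a c ha hac := hT.modus_ponens _ _ hac <| hT.modus_ponens _ _ ha <|
    hT.mem_of_tautology hΛ fun v _ h => by simp only [h]; tauto

theorem exists_isWorld (hΛ : IsNormalLogic Λ) (hT : IsModalTheory Λ T) (ha : a ∉ T) :
    ∃ m, IsWorld Λ m ∧ T ⊆ m ∧ a ∉ m := by
  obtain ⟨m, hTm, hm⟩ := zorn_subset_nonempty {U | IsModalTheory Λ U ∧ a ∉ U} (by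
    rintro C hC hchain ⟨U₀, hU₀⟩
    refine ⟨⋃₀ C, ⟨⟨fun c hc => ⟨U₀, hU₀, (hC hU₀).1.subset hc⟩, ?_⟩, ?_⟩,
      fun U hU => Set.subset_sUnion_of_mem hU⟩
    · rintro b c ⟨U, hU, hb⟩ ⟨V, hV, hbc⟩
      rcases hchain.total hU hV with h | h
      · exact ⟨V, hV, (hC hV).1.modus_ponens b c (h hb) hbc⟩
      · exact ⟨U, hU, (hC hU).1.modus_ponens b c hb (h hbc)⟩
    · rintro ⟨U, hU, haU⟩
      exact (hC hU).2 haU) T ⟨hT, ha⟩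
  have hth := hm.prop.1
  -- Adjoining `b` gives a theory that properly extends `m`, so by maximality it must contain `a`.
  have hnot : ∀ b, b ∉ m → imp b a ∈ m := by
    intro b hb
    by_contra hba
    refine hb (hm.le_of_ge (y := {c | imp b c ∈ m}) ⟨hth.adjoin hΛ b, hba⟩ (fun c hc => ?_) ?_)
    · exact hth.modus_ponens c _ hc (hth.mem_of_tautology hΛ fun v _ h => by simp only [h]; tauto)
    · exact hth.mem_of_tautology hΛ (a := imp b b) fun v _ h => by simp only [h]; tauto
  refine ⟨m, ⟨hth.subset, fun hbot => hm.prop.2 ?_, fun b c => ⟨fun h hb => ?_, fun h => ?_⟩⟩,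
    hTm, hm.prop.2⟩
  · exact hth.modus_ponens _ _ hbot
      (hth.mem_of_tautology hΛ fun v h0 h => by simp only [h]; tauto)
  · exact hth.modus_ponens _ _ hb h
  · by_contra hbc
    by_cases hb : b ∈ m
    · exact hbc (hth.modus_ponens _ _ (h hb)
        (hth.mem_of_tautology hΛ fun v _ h => by simp only [h]; tauto))
    -- If neither `b` nor `b → c` is in `m`, both imply `a` in `m`; classically one of the two
    -- holds, so `a` follows.
    · exact hm.prop.2 (hth.modus_ponens _ _ (hnot _ hbc) <| hth.modus_ponens _ _ (hnot _ hb) <|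
        hth.mem_of_tautology hΛ fun v _ h => by simp only [h]; tauto)

theorem exists_isWorld_of_notMem (hΛ : IsNormalLogic Λ) (ha : a ∉ Λ) :
    ∃ m, IsWorld Λ m ∧ a ∉ m := by
  obtain ⟨m, hm, -, h⟩ := exists_isWorld hΛ ⟨subset_rfl, hΛ.modus_ponens⟩ ha
  exact ⟨m, hm, h⟩

namespace IsWorld

theorem neg_mem (hm : IsWorld Λ m) : neg a ∈ m ↔ a ∉ m := by
  simp [neg, hm.imp_mem, hm.bot_notMem]

theorem or_mem (hm : IsWorld Λ m) : a.or b ∈ m ↔ a ∈ m ∨ b ∈ m := by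
  simp [ModalFormula.or, hm.imp_mem, hm.neg_mem]; tauto

theorem and_mem (hm : IsWorld Λ m) : a.and b ∈ m ↔ a ∈ m ∧ b ∈ m := by
  simp [ModalFormula.and, hm.imp_mem, hm.neg_mem]

theorem mp (hm : IsWorld Λ m) (h : imp a b ∈ Λ) (ha : a ∈ m) : b ∈ m :=
  (hm.imp_mem a b).1 (hm.subset h) ha

end IsWorld

theorem IsNormalLogic.imp_mem_of_forall (hΛ : IsNormalLogic Λ)
    (h : ∀ m, IsWorld Λ m → a ∈ m → b ∈ m) : imp a b ∈ Λ := by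
  by_contra hab
  obtain ⟨m, hm, hn⟩ := exists_isWorld_of_notMem hΛ hab
  exact hn ((hm.imp_mem a b).2 (h m hm))

theorem IsWorld.dia_mono (hm : IsWorld Λ m) (hΛ : IsNormalLogic Λ)
    (h : ∀ m, IsWorld Λ m → a ∈ m → b ∈ m) (ha : dia a ∈ m) : dia b ∈ m :=
  hm.mp (hΛ.monotonicity _ _ (hΛ.imp_mem_of_forall h)) ha

theorem IsWorld.dia_or (hm : IsWorld Λ m) (hΛ : IsNormalLogic Λ) (h : dia (a.or b) ∈ m) :
    dia a ∈ m ∨ dia b ∈ m := by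
  have := hΛ.substitution _ hΛ.dia_or fun n => if n = 0 then a else b
  exact hm.or_mem.1 (hm.mp this h)

theorem IsWorld.dia_false (hm : IsWorld Λ m) (hΛ : IsNormalLogic Λ)
    (h : ∀ m, IsWorld Λ m → a ∉ m) : dia a ∉ m := fun ha =>
  hm.neg_mem.1 (hm.subset hΛ.dia_bot)
    (hm.dia_mono hΛ (fun n hn han => absurd han (h n hn)) ha)

/-- A possible formula holds in some world that is seen. -/
theorem IsWorld.exists_sees (hm : IsWorld Λ m) (hΛ : IsNormalLogic Λ) (hb : dia b ∈ m) :
    ∃ n, IsWorld Λ n ∧ Sees m n ∧ b ∈ n := by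
  -- These are the `c` with `□(b → c)` in `m`. A world above them contains `b`, and contains `¬c`
  -- whenever `◇c` is not in `m`.
  have hT : IsModalTheory Λ {c | dia (b.and (neg c)) ∉ m} := by
    refine ⟨fun c hc => hm.dia_false hΛ fun n hn h => ?_, fun c d hc hcd h => ?_⟩
    · exact hn.neg_mem.1 (hn.and_mem.1 h).2 (hn.subset hc)
    · have := hm.dia_mono (b := (b.and (neg c)).or (b.and (neg (imp c d)))) hΛ
        (fun n hn h => by
          simp only [hn.and_mem, hn.or_mem, hn.neg_mem, hn.imp_mem] at h ⊢; tauto) h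
      exact (hm.dia_or hΛ this).elim hc hcd
  have hbot : bot ∉ {c | dia (b.and (neg c)) ∉ m} := fun h => h <|
    hm.dia_mono hΛ (fun n hn h => hn.and_mem.2 ⟨h, hn.neg_mem.2 hn.bot_notMem⟩) hb
  obtain ⟨n, hn, hTn, -⟩ := exists_isWorld hΛ hT hbot
  refine ⟨n, hn, fun c hc => ?_, hTn ?_⟩
  · by_contra hdc
    refine hn.neg_mem.1 (hTn (a := neg c) fun h => hdc ?_) hc
    refine hm.dia_mono hΛ (fun k hk h => ?_) h
    simp only [hk.and_mem, hk.neg_mem] at h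
    tauto
  · exact hm.dia_false hΛ fun k hk h => by
      simp only [hk.and_mem, hk.neg_mem] at h; tauto

theorem Sees.refl (hΛ : IsS4Logic Λ) (hm : IsWorld Λ m) : Sees m m :=
  fun a ha => hm.mp (hΛ.refl a) ha

theorem Sees.trans {k : Set ModalFormula} (hΛ : IsS4Logic Λ) (hm : IsWorld Λ m)
    (h₁ : Sees m n) (h₂ : Sees n k) : Sees m k :=
  fun a ha => hm.mp (hΛ.trans a) (h₁ _ (h₂ a ha))

theorem IsWorld.box_mem (hm : IsWorld Λ m) : box a ∈ m ↔ dia (neg a) ∉ m := hm.neg_mem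

theorem Sees.mem_of_box (hm : IsWorld Λ m) (hn : IsWorld Λ n) (h : Sees m n)
    (ha : box a ∈ m) : a ∈ n := by
  by_contra hna
  exact hm.box_mem.1 ha (h _ (hn.neg_mem.2 hna))

theorem IsWorld.box_mem_of_forall (hm : IsWorld Λ m) (hΛ : IsNormalLogic Λ)
    (h : ∀ n, IsWorld Λ n → Sees m n → a ∈ n) : box a ∈ m := by
  refine hm.box_mem.2 fun hd => ?_
  obtain ⟨n, hn, hs, ha⟩ := hm.exists_sees hΛ hd
  exact hn.neg_mem.1 ha (h n hn hs)

theorem IsWorld.box_box (hm : IsWorld Λ m) (hΛ : IsS4Logic Λ) (h : box a ∈ m) :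
    box (box a) ∈ m :=
  hm.box_mem_of_forall hΛ.1 fun _ hn hmn => hn.box_mem_of_forall hΛ.1 fun _ hk hnk =>
    (hmn.trans hΛ hm hnk).mem_of_box hm hk h

/-! ### The greatest world in S4.2.1 -/

theorem IsWorld.dia_box_iff (hm : IsWorld logicS421 m) :
    dia (box a) ∈ m ↔ box (dia a) ∈ m := by
  have := hm.subset (box_dia_iff_mem_logicS421 a)
  rw [ModalFormula.iff, hm.and_mem, hm.imp_mem, hm.imp_mem] at this
  tauto

theorem IsWorld.dia_box_box (hm : IsWorld logicS421 m) (h : dia (box a) ∈ m) :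
    dia (box (box a)) ∈ m :=
  hm.dia_mono logicS421_isS4Logic.1 (fun _ hn h => hn.box_box logicS421_isS4Logic h) h

/-- The greatest world seen from a world of `S4.2.1`. -/
def finalWorld (m : Set ModalFormula) : Set ModalFormula := {a | dia (box a) ∈ m}

/-- Closure under modus ponens uses `◇□ → □◇`: a world with `□(b → c)` sees one that also has `□b`.
Completeness uses `□◇ → ◇□`: if `◇□b` fails then `□◇¬b` holds, hence `◇□¬b`. -/
theorem IsWorld.finalWorld_isWorld (hm : IsWorld logicS421 m) :
    IsWorld logicS421 (finalWorld m) := by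
  have hΛ := logicS421_isS4Logic
  have hbot : bot ∉ finalWorld m := hm.dia_false hΛ.1 fun n hn h =>
    hn.bot_notMem ((Sees.refl hΛ hn).mem_of_box hn hn h)
  have hmp : ∀ b c, imp b c ∈ finalWorld m → b ∈ finalWorld m → c ∈ finalWorld m := by
    intro b c hbc hb
    have hb' := hm.dia_box_iff.1 (hm.dia_box_box hb)
    obtain ⟨x, hx, hmx, hxb⟩ := hm.exists_sees hΛ.1 hbc
    obtain ⟨y, hy, hxy, hyb⟩ := hx.exists_sees hΛ.1 (hmx.mem_of_box hm hx hb')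
    refine hmx.trans hΛ hm hxy _ (hy.box_mem_of_forall hΛ.1 fun z hz hyz => ?_)
    exact (hz.imp_mem b c).1 ((hxy.trans hΛ hx hyz).mem_of_box hx hz hxb)
      (hyz.mem_of_box hy hz hyb)
  have hsub : logicS421 ⊆ finalWorld m := fun a ha => Sees.refl hΛ hm _
    (hm.box_mem_of_forall hΛ.1 fun n hn _ => hn.subset ha)
  refine ⟨hsub, hbot, fun b c => ⟨hmp b c, fun h => ?_⟩⟩
  by_cases hb : b ∈ finalWorld m
  · exact hmp c _ (hsub (hΛ.tautology _ fun v _ h => by simp only [h]; tauto)) (h hb)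
  · refine hmp (neg b) _ (hsub (hΛ.tautology _ fun v h0 h => by
      simp only [neg, h]; tauto)) (hm.dia_box_iff.2 (hm.box_mem_of_forall hΛ.1 fun n hn hmn => ?_))
    by_contra hd
    refine hb (hmn _ (hn.box_mem.2 hd))

theorem IsWorld.sees_finalWorld (hm : IsWorld logicS421 m) (hn : IsWorld logicS421 n)
    (h : Sees m n) : Sees n (finalWorld m) :=
  fun _ ha => h.mem_of_box hm hn (hm.dia_box_iff.1 ha)

/-- The final world contains `□¬a` together with `¬a`, because `◇□¬a` gives `◇□□¬a`. -/
theorem IsWorld.dia_mem_finalWorld (hm : IsWorld logicS421 m) :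
    dia a ∈ finalWorld m ↔ a ∈ finalWorld m := by
  have hu := hm.finalWorld_isWorld
  refine ⟨fun h => ?_, Sees.refl logicS421_isS4Logic hu a⟩
  by_contra ha
  have : box (neg a) ∈ finalWorld m := hm.dia_box_box (hu.neg_mem.2 ha)
  obtain ⟨n, hn, hs, han⟩ := hu.exists_sees logicS421_isS4Logic.1 h
  exact hn.neg_mem.1 (hs.mem_of_box hu hn this) han

/-! ### Enumerating formulas and unravelling a world -/

namespace ModalFormula

/-- An injective coding of formulas by numbers. -/
def code : ModalFormula → ℕ
  | var n => 4 * n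
  | bot => 1
  | imp a b => 4 * Nat.pair (code a) (code b) + 2
  | dia a => 4 * code a + 3

theorem code_injective : Function.Injective code := by
  intro a
  induction a with
  | var n => intro b h; cases b <;> simp only [code] at h <;> first | omega | (congr 1; omega)
  | bot => intro b h; cases b <;> simp only [code] at h <;> first | omega | rfl
  | imp a₁ a₂ ih₁ ih₂ =>
    intro b h
    cases b with
    | imp b₁ b₂ =>
      simp only [code, Nat.add_right_cancel_iff, mul_eq_mul_left_iff, Nat.pair_eq_pair] at h
      rcases h with ⟨h₁, h₂⟩ | h
      · rw [ih₁ h₁, ih₂ h₂]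
      · omega
    | _ => simp only [code] at h; omega
  | dia a ih =>
    intro b h
    cases b with
    | dia b => simp only [code] at h; rw [ih (a₂ := b) (by omega)]
    | _ => simp only [code] at h; omega

theorem exists_surjective_nat : ∃ e : ℕ → ModalFormula, Function.Surjective e :=
  have : Countable ModalFormula := code_injective.countable
  have : Nonempty ModalFormula := ⟨bot⟩
  _root_.exists_surjective_nat _

end ModalFormula

/-- A world of a logic that includes `S4` unravels to a tree of worlds, whose nodes are the lists of
numbers, a list being above its suffixes. -/
theorem IsWorld.exists_tree (hΛ : IsS4Logic Λ) (hm : IsWorld Λ m) :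
    ∃ t : List ℕ → Set ModalFormula, t [] = m ∧ (∀ x, IsWorld Λ (t x)) ∧
      (∀ x y, x <:+ y → Sees (t x) (t y)) ∧ ∀ x a, dia a ∈ t x → ∃ i, a ∈ t (i :: x) := by
  obtain ⟨e, he⟩ := ModalFormula.exists_surjective_nat
  -- The `i`-th child witnesses the `i`-th formula if that is possible at its parent, and otherwise
  -- repeats the parent, so every node has all children.
  have hstep : ∀ (i : ℕ) (n : Set ModalFormula), ∃ k, IsWorld Λ n →
      IsWorld Λ k ∧ Sees n k ∧ (dia (e i) ∈ n → e i ∈ k) := by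
    intro i n
    by_cases hn : IsWorld Λ n
    · by_cases hd : dia (e i) ∈ n
      · obtain ⟨k, hk, h₁, h₂⟩ := hn.exists_sees hΛ.1 hd
        exact ⟨k, fun _ => ⟨hk, h₁, fun _ => h₂⟩⟩
      · exact ⟨n, fun _ => ⟨hn, Sees.refl hΛ hn, fun h => absurd h hd⟩⟩
    · exact ⟨n, fun h => absurd h hn⟩
  choose step hstep using hstep
  have hw : ∀ x : List ℕ, IsWorld Λ (x.foldr step m) := by
    intro x
    induction x with
    | nil => exact hm
    | cons i x ih => exact (hstep i _ ih).1
  refine ⟨fun x => x.foldr step m, rfl, hw, ?_, fun x a ha => ?_⟩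
  · rintro x _ ⟨z, rfl⟩
    induction z with
    | nil => exact Sees.refl hΛ (hw x)
    | cons i z ih => exact ih.trans hΛ (hw x) (hstep i _ (hw _)).2.1
  · obtain ⟨i, rfl⟩ := he a
    exact ⟨i, (hstep i _ (hw x)).2.2 ha⟩

/-! ### Soundness -/

namespace ModelTheoreticLanguage

open FirstOrder FirstOrder.Language

variable {Ω : FirstOrder.Language.{u, v}} {L : ModelTheoreticLanguage.{u, v, w, s} Ω}
  {f : L.Sent → L.Sent} {θ : ℕ → L.Sent} {A : SigModel.{u, v, w} Ω} {a b : ModalFormula}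

theorem containsSubmodel_iff {A B : SigModel.{u, v, w} Ω} :
    ContainsSubmodel A B ↔ Nonempty (B ↪[Ω] A) :=
  ⟨fun ⟨S, ⟨e⟩⟩ => ⟨S.subtype.comp e.toEmbedding⟩, fun ⟨e⟩ => ⟨_, ⟨e.equivRange⟩⟩⟩

theorem sat_extend_dia (hf : L.Expresses f Set.univ ContainsSubmodel) :
    L.Sat A (L.extend f θ (dia a)) ↔
      ∃ B : SigModel.{u, v, w} Ω, Nonempty (B ↪[Ω] A) ∧ L.Sat B (L.extend f θ a) := by
  simp [extend, hf _ A trivial, containsSubmodel_iff]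

theorem not_sat_bot : ¬ L.Sat A L.bot := by
  simp [bot, L.sat_ofFirstOrder, Sentence.Realize]

theorem sat_extend_imp : L.Sat A (L.extend f θ (a.imp b)) ↔
    (L.Sat A (L.extend f θ a) → L.Sat A (L.extend f θ b)) :=
  L.sat_imp _ _ _

theorem sat_extend_neg : L.Sat A (L.extend f θ (neg a)) ↔ ¬ L.Sat A (L.extend f θ a) := by
  rw [neg, sat_extend_imp, extend]
  simp [not_sat_bot]

theorem sat_extend_or : L.Sat A (L.extend f θ (a.or b)) ↔
    L.Sat A (L.extend f θ a) ∨ L.Sat A (L.extend f θ b) := by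
  rw [ModalFormula.or, sat_extend_imp, sat_extend_neg]
  tauto

theorem sat_extend_iff : L.Sat A (L.extend f θ (a.iff b)) ↔
    (L.Sat A (L.extend f θ a) ↔ L.Sat A (L.extend f θ b)) := by
  simp only [ModalFormula.iff, ModalFormula.and, sat_extend_imp, sat_extend_neg]
  tauto

theorem sat_extend_box (hf : L.Expresses f Set.univ ContainsSubmodel) :
    L.Sat A (L.extend f θ (box a)) ↔
      ∀ B : SigModel.{u, v, w} Ω, Nonempty (B ↪[Ω] A) → L.Sat B (L.extend f θ a) := by
  simp [box, sat_extend_neg, sat_extend_dia hf]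

theorem extend_subst (σ : ℕ → ModalFormula) (a : ModalFormula) :
    L.extend f θ (subst σ a) = L.extend f (fun n => L.extend f θ (σ n)) a := by
  induction a with
  | var n => rfl
  | bot => rfl
  | imp a b iha ihb => simp [subst, extend, iha, ihb]
  | dia a ih => simp [subst, extend, ih]

theorem mem_modalTheory : a ∈ L.modalTheory (L.theoryOf Set.univ) f ↔
    ∀ (θ : ℕ → L.Sent) (A : SigModel.{u, v, w} Ω), L.Sat A (L.extend f θ a) := by
  simp [modalTheory, theoryOf]

theorem modalTheory_isS4Logic (hf : L.Expresses f Set.univ ContainsSubmodel) :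
    IsS4Logic (L.modalTheory (L.theoryOf Set.univ) f) := by
  refine ⟨⟨fun a ha => ?_, ?_, ?_, fun a b ha hab => ?_, fun a ha σ => ?_, fun a b hab => ?_⟩,
    fun a => ?_, fun a => ?_⟩ <;> rw [mem_modalTheory] at * <;> intro θ A
  · exact ha (fun c => L.Sat A (L.extend f θ c)) not_sat_bot fun _ _ => sat_extend_imp
  · rw [sat_extend_neg, sat_extend_dia hf]
    exact fun ⟨_, _, h⟩ => not_sat_bot h
  · simp only [sat_extend_imp, sat_extend_or, sat_extend_dia hf]
    rintro ⟨B, hB, h | h⟩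
    exacts [.inl ⟨B, hB, h⟩, .inr ⟨B, hB, h⟩]
  · exact sat_extend_imp.1 (hab θ A) (ha θ A)
  · rw [extend_subst]
    exact ha _ A
  · simp only [sat_extend_imp, sat_extend_dia hf] at hab ⊢
    exact fun ⟨B, hB, h⟩ => ⟨B, hB, hab θ B h⟩
  · simp only [sat_extend_imp, sat_extend_dia hf]
    exact fun ⟨B, ⟨e⟩, C, ⟨e'⟩, h⟩ => ⟨C, ⟨e.comp e'⟩, h⟩
  · simp only [sat_extend_imp, sat_extend_dia hf]
    exact fun h => ⟨A, ⟨Embedding.refl Ω A⟩, h⟩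

/-- In the presence of constants, every model has a least submodel. -/
theorem exists_least_submodel [Nonempty Ω.Constants] (A : SigModel.{u, v, w} Ω) :
    ∃ M : SigModel.{u, v, w} Ω, (∀ B : SigModel.{u, v, w} Ω, Nonempty (B ↪[Ω] A) →
        Nonempty (M ↪[Ω] B)) ∧
      ∀ C : SigModel.{u, v, w} Ω, Nonempty (C ↪[Ω] M) → Nonempty (C ≃[Ω] M) := by
  obtain ⟨c⟩ := ‹Nonempty Ω.Constants›
  have hne : Nonempty (⊥ : Ω.Substructure A) := ⟨⟨_, Substructure.constants_mem c⟩⟩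
  refine ⟨Theory.ModelType.of ∅ (⊥ : Ω.Substructure A), fun B ⟨e⟩ => ?_, fun C ⟨e⟩ => ?_⟩
  · exact ⟨e.equivRange.symm.toEmbedding.comp (Substructure.inclusion bot_le)⟩
  · refine ⟨⟨Equiv.ofBijective e ⟨e.injective, fun ⟨x, hx⟩ => ?_⟩, e.map_fun', e.map_rel'⟩⟩
    -- Surjectivity: the image of `C` is a substructure of `A`, hence contains the least one.
    have hx' : x ∈ ((⊥ : Ω.Substructure A).subtype.comp e).toHom.range :=
      (bot_le : (⊥ : Ω.Substructure A) ≤ _) hx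
    obtain ⟨y, hy⟩ := hx'
    exact ⟨y, Subtype.ext hy⟩

theorem logicS421_subset_modalTheory [Nonempty Ω.Constants]
    (hf : L.Expresses f Set.univ ContainsSubmodel) :
    logicS421 ⊆ L.modalTheory (L.theoryOf Set.univ) f := by
  have hS4 := modalTheory_isS4Logic hf
  refine leastNormalLogic_subset hS4.1 (Set.union_subset (leastNormalLogic_subset hS4.1 ?_) ?_)
  · rintro a (rfl | rfl)
    exacts [hS4.trans _, hS4.refl _]
  · rintro a rfl
    rw [mem_modalTheory]
    intro θ A
    simp only [sat_extend_iff, sat_extend_box hf, sat_extend_dia hf]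
    obtain ⟨M, hM, hmin⟩ := exists_least_submodel A
    have hMA := hM A ⟨Embedding.refl Ω A⟩
    constructor
    · intro h
      obtain ⟨C, hC, hCp⟩ := h M hMA
      obtain ⟨e⟩ := hmin C hC
      refine ⟨M, hMA, fun D hD => ?_⟩
      obtain ⟨e'⟩ := hmin D hD
      exact L.sat_of_equiv C D (e'.symm.comp e) _ hCp
    · rintro ⟨B, hB, h⟩ D hD
      exact ⟨M, hM D hD, h M (hM B hB)⟩

end ModelTheoreticLanguage

/-! ### A multiplication on lists whose closed sets are cones -/

/-- The longest common suffix. -/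
def commonSuffix : List ℕ → List ℕ → List ℕ
  | [], _ => []
  | a :: x, y => if a :: x <:+ y then a :: x else commonSuffix x y

theorem commonSuffix_suffix_left (x y : List ℕ) : commonSuffix x y <:+ x := by
  induction x with
  | nil => simp [commonSuffix]
  | cons a x ih =>
    rw [commonSuffix]
    split_ifs
    · exact List.suffix_rfl
    · exact ih.trans (List.suffix_cons a x)

theorem commonSuffix_suffix_right (x y : List ℕ) : commonSuffix x y <:+ y := by
  induction x with
  | nil => simp [commonSuffix]
  | cons a x ih => rw [commonSuffix]; split_ifs <;> assumption

theorem suffix_commonSuffix {x y z : List ℕ} (hx : z <:+ x) (hy : z <:+ y) :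
    z <:+ commonSuffix x y := by
  induction x with
  | nil => simpa [commonSuffix] using hx
  | cons a x ih =>
    rw [commonSuffix]
    split_ifs with h
    · exact hx
    · rcases List.suffix_cons_iff.1 hx with rfl | hx
      exacts [absurd hy h, ih hx]

open Classical in
/-- A multiplication on the tree of lists such that the nonempty closed sets are the cones. The
parameter `b` labels the nodes by sets of numbers. -/
noncomputable def treeMul (b : List ℕ → ℕ → Prop) (x y : List ℕ) : List ℕ :=
  if y = x then 0 :: x
  else if y = y.headI :: x then (y.headI + 1) :: x
  else if y = 0 :: y.tail.headI :: x then if b x y.tail.headI then x else 0 :: x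
  else commonSuffix x y

section treeMul

variable (b : List ℕ → ℕ → Prop) {x y z : List ℕ}

theorem treeMul_self (x : List ℕ) : treeMul b x x = 0 :: x := if_pos rfl

theorem treeMul_cons (x : List ℕ) (j : ℕ) : treeMul b x (j :: x) = (j + 1) :: x := by
  simp [treeMul]

open Classical in
theorem treeMul_zero_cons_cons (x : List ℕ) (j : ℕ) :
    treeMul b x (0 :: j :: x) = if b x j then x else 0 :: x := by
  have : 0 :: j :: x ≠ x := fun h => by have := congrArg List.length h; simp at this; omega
  simp [treeMul, this]
  rfl

theorem treeMul_cases (x y : List ℕ) : y = x ∨ (∃ j, y = j :: x) ∨ (∃ j, y = 0 :: j :: x) ∨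
    treeMul b x y = commonSuffix x y := by
  unfold treeMul
  split_ifs with h₁ h₂ h₃
  · exact .inl h₁
  · exact .inr (.inl ⟨_, h₂⟩)
  · exact .inr (.inr (.inl ⟨_, h₃⟩))
  · exact .inr (.inr (.inl ⟨_, h₃⟩))
  · exact .inr (.inr (.inr rfl))

/-- By this the root of a cone absorbs the other nodes, which is how `RootProperty` singles it out.
-/
theorem treeMul_of_suffix (h : x <:+ y) (hne : y ≠ x) : treeMul b y x = x := by
  have hlen : x.length < y.length :=
    lt_of_le_of_ne h.length_le fun he => hne (h.eq_of_length he).symm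
  rcases treeMul_cases b y x with rfl | ⟨j, rfl⟩ | ⟨j, rfl⟩ | h'
  · exact absurd rfl hne
  · simp at hlen
  · simp at hlen; omega
  · rw [h']
    have h₁ := commonSuffix_suffix_right y x
    exact h₁.eq_of_length_le (suffix_commonSuffix h List.suffix_rfl).length_le

theorem suffix_treeMul (hx : z <:+ x) (hy : z <:+ y) : z <:+ treeMul b x y := by
  rcases treeMul_cases b x y with rfl | ⟨j, rfl⟩ | ⟨j, rfl⟩ | h
  · rw [treeMul_self]; exact hx.trans (List.suffix_cons _ _)
  · rw [treeMul_cons]; exact hx.trans (List.suffix_cons _ _)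
  · rw [treeMul_zero_cons_cons]
    split_ifs
    exacts [hx, hx.trans (List.suffix_cons _ _)]
  · rw [h]; exact suffix_commonSuffix hx hy

/-- The root is a shortest element `x`: the product of `x` with an element not covered by the
special clauses is a suffix of `x`, so it equals `x`. Conversely `x * x = 0 :: x` and `x * (j :: x)
= (j + 1) :: x` produce all children, hence the cone. -/
theorem exists_cone {S : Set (List ℕ)} (hS : ∀ x ∈ S, ∀ y ∈ S, treeMul b x y ∈ S)
    (hne : S.Nonempty) : ∃ x, ∀ y, y ∈ S ↔ x <:+ y := by
  obtain ⟨x, hx, hmin⟩ := exists_minimalFor_of_wellFoundedLT (· ∈ S) List.length hne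
  have hle : ∀ y ∈ S, x.length ≤ y.length := fun y hy =>
    (le_total _ _).elim id fun h => hmin hy h
  refine ⟨x, fun y => ⟨fun hy => ?_, ?_⟩⟩
  · rcases treeMul_cases b x y with rfl | ⟨j, rfl⟩ | ⟨j, rfl⟩ | h
    · exact List.suffix_rfl
    · exact List.suffix_cons _ _
    · exact (List.suffix_cons _ _).trans (List.suffix_cons _ _)
    · have h₁ := hle _ (h ▸ hS x hx y hy)
      rw [← (commonSuffix_suffix_left x y).eq_of_length_le h₁]
      exact commonSuffix_suffix_right x y
  · rintro ⟨z, rfl⟩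
    induction z with
    | nil => exact hx
    | cons i z ih =>
      induction i with
      | zero => simpa [treeMul_self] using hS _ ih _ ih
      | succ j hj => simpa [treeMul_cons] using hS _ ih _ hj

end treeMul

/-- The multiplication on the tree with a new neutral element `none`. -/
noncomputable def optMul (b : List ℕ → ℕ → Prop) : Option (List ℕ) → Option (List ℕ) →
    Option (List ℕ)
  | none, y => y
  | some x, none => some x
  | some x, some y => some (treeMul b x y)

/-- The elements `x * x`, `x * (x * x)`, `x * (x * (x * x))`, ... -/
def iterMul {M : Type*} (mul : M → M → M) (x : M) : ℕ → M
  | 0 => mul x x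
  | j + 1 => mul x (iterMul mul x j)

/-- In the submagma of the tree with root `x`, the property `b x j`. -/
def RootProperty {M : Type*} (mul : M → M → M) (j : ℕ) : Prop :=
  ∃ x, (∀ y, y = x ∨ mul y x = x) ∧ mul x (mul (iterMul mul x j) (iterMul mul x j)) = x

section RootProperty

variable {M : Type*} {mul : M → M → M} {b : List ℕ → ℕ → Prop} {g : M → Option (List ℕ)}

/-- The submodel `{none}` thus has every root property, so the valuation must be adjusted to give it
prescribed variables. -/
theorem rootProperty_of_subsingleton [Nonempty M] (h : ∀ x y : M, x = y) (j : ℕ) :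
    RootProperty mul j :=
  ⟨Classical.arbitrary M, fun _ => .inl (h _ _), h _ _⟩

theorem map_iterMul (hmul : ∀ x y, g (mul x y) = optMul b (g x) (g y)) {r : M} {x : List ℕ}
    (hr : g r = some x) (j : ℕ) : g (iterMul mul r j) = some (j :: x) := by
  induction j with
  | zero => rw [iterMul, hmul, hr, optMul, treeMul_self]
  | succ j ih => rw [iterMul, hmul, hr, ih, optMul, treeMul_cons]

/-- At the root `x` the iterate is `j :: x`, its square is `0 :: j :: x`, and the product of `x`
with that square returns `x` exactly when `b x j`. -/
theorem rootProperty_iff (hg : Function.Injective g)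
    (hmul : ∀ x y, g (mul x y) = optMul b (g x) (g y)) {x : List ℕ}
    (hx : ∀ y, (∃ z, g z = some y) ↔ x <:+ y) (j : ℕ) : RootProperty mul j ↔ b x j := by
  obtain ⟨r, hr⟩ := (hx x).2 List.suffix_rfl
  have htest : mul r (mul (iterMul mul r j) (iterMul mul r j)) = r ↔ b x j := by
    rw [← hg.eq_iff]
    simp only [hmul, map_iterMul hmul hr, hr, optMul, treeMul_self, treeMul_zero_cons_cons]
    split_ifs with h <;> simp [h]
  -- A node other than the root has its parent `p` in the cone, and `p` sends it to its next
  -- sibling; `none` fails because it fixes `r` instead of absorbing it.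
  have hroot : ∀ r', (∀ y, y = r' ∨ mul y r' = r') ↔ r' = r := by
    intro r'
    constructor
    · intro h
      rcases h r with h | h
      · exact h.symm
      rw [← hg.eq_iff, hmul, hr] at h
      cases hr' : g r' with
      | none => simp [hr', optMul] at h
      | some y =>
        rcases y with _ | ⟨i, y⟩
        · have := List.suffix_nil.1 ((hx []).1 ⟨r', hr'⟩)
          exact hg (by rw [hr', hr, this])
        · rcases List.suffix_cons_iff.1 ((hx _).1 ⟨r', hr'⟩) with hxy | hxy
          · exact hg (by rw [hr', hr, hxy])
          · obtain ⟨p, hp⟩ := (hx y).2 hxy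
            have := ‹∀ y, y = r' ∨ mul y r' = r'› p
            rw [← hg.eq_iff, ← hg.eq_iff, hmul, hp, hr', optMul, treeMul_cons] at this
            simp at this
    · rintro rfl y
      rw [← hg.eq_iff, ← hg.eq_iff, hmul, hr]
      cases hy : g y with
      | none => exact .inr rfl
      | some y' =>
        by_cases hne : y' = x
        · exact .inl (by rw [hne])
        · exact .inr (by rw [optMul, treeMul_of_suffix b ((hx y').1 ⟨y, hy⟩) hne])
  simp [RootProperty, hroot, htest]

end RootProperty

/-! ### The tree as an `Ω`-structure and its submodels -/

namespace ModelTheoreticLanguage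

open FirstOrder FirstOrder.Language

variable {Ω : FirstOrder.Language.{u, v}} {b : List ℕ → ℕ → Prop}

/-- The universe of the tree structure with labels `b` and a neutral element. -/
def TreeModel (_ : List ℕ → ℕ → Prop) : Type := Option (List ℕ)

/-- Unary symbols act as the identity and constants name `none`, so they generate no nodes:
substructures are governed by the multiplication alone. -/
noncomputable instance TreeModel.structure (b : List ℕ → ℕ → Prop) :
    Ω.Structure (TreeModel b) where
  funMap {n} _ x := if h : 2 ≤ n then optMul b (x ⟨0, by omega⟩) (x ⟨1, by omega⟩)
    else if h : n = 1 then x ⟨0, by omega⟩ else (none : Option (List ℕ))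
  RelMap _ _ := False

theorem funMap_of_two_le {n : ℕ} (h : 2 ≤ n) (F : Ω.Functions n) (x : Fin n → TreeModel b) :
    Structure.funMap F x = optMul b (x ⟨0, by omega⟩) (x ⟨1, by omega⟩) :=
  dif_pos h

theorem funMap_zero (F : Ω.Functions 0) (x : Fin 0 → TreeModel b) :
    Structure.funMap F x = (none : Option (List ℕ)) :=
  rfl

/-- The elements of the structure generated by the node `x`. -/
def InCone (Ω : FirstOrder.Language.{u, v}) (x : List ℕ) (z : Option (List ℕ)) : Prop :=
  (z = none ∧ Nonempty Ω.Constants) ∨ ∃ y, z = some y ∧ x <:+ y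

theorem InCone.optMul {x : List ℕ} {z₀ z₁ : Option (List ℕ)} (h₀ : InCone Ω x z₀)
    (h₁ : InCone Ω x z₁) : InCone Ω x (optMul b z₀ z₁) := by
  rcases h₀ with ⟨rfl, hc⟩ | ⟨y₀, rfl, hy₀⟩
  · exact h₁
  · rcases h₁ with ⟨rfl, -⟩ | ⟨y₁, rfl, hy₁⟩
    exacts [.inr ⟨y₀, rfl, hy₀⟩, .inr ⟨_, rfl, suffix_treeMul b hy₀ hy₁⟩]

/-- The substructure generated by a node. -/
def coneSubstructure (Ω : FirstOrder.Language.{u, v}) (b : List ℕ → ℕ → Prop) (x : List ℕ) :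
    Ω.Substructure (TreeModel b) where
  carrier := {z | InCone Ω x z}
  fun_mem {n} F z hz := by
    rcases n with _ | _ | n
    · exact .inl ⟨funMap_zero F z, ⟨F⟩⟩
    · exact hz 0
    · rw [funMap_of_two_le (by omega)]
      exact (hz _).optMul (hz _)

/-- The model generated by a node. -/
noncomputable def coneModel (Ω : FirstOrder.Language.{u, v}) (b : List ℕ → ℕ → Prop)
    (x : List ℕ) : SigModel.{u, v, w} Ω :=
  have : Nonempty (coneSubstructure Ω b x) := ⟨⟨_, .inr ⟨x, rfl, List.suffix_rfl⟩⟩⟩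
  Theory.ModelType.ulift.{u, v, 0, w} (Theory.ModelType.of ∅ (coneSubstructure Ω b x))

/-- The isomorphism of a lifted model to the given one. -/
noncomputable def coneModelEquiv (x : List ℕ) :
    (coneModel Ω b x : SigModel.{u, v, w} Ω) ≃[Ω] coneSubstructure Ω b x :=
  let e := (_root_.Equiv.ulift.{w, 0} (α := coneSubstructure Ω b x)).symm
  letI := e.inducedStructure (L := Ω)
  e.inducedStructureEquiv.symm

/-- The term `F(t₁, t₂, ..., t₂)`. -/
def mulTerm {n : ℕ} (F : Ω.Functions n) {α : Type*} (t₁ t₂ : Ω.Term α) : Ω.Term α :=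
  .func F fun i => if i.val = 0 then t₁ else t₂

/-- The operation `F(x, y, ..., y)`. -/
def mulMap {n : ℕ} (F : Ω.Functions n) {M : Type*} [Ω.Structure M] (x y : M) : M :=
  Structure.funMap F fun i => if i.val = 0 then x else y

theorem realize_mulTerm {n : ℕ} (F : Ω.Functions n) {α M : Type*} [Ω.Structure M]
    (t₁ t₂ : Ω.Term α) (x : α → M) :
    (mulTerm F t₁ t₂).realize x = mulMap F (t₁.realize x) (t₂.realize x) := by
  simp only [mulTerm, mulMap, Term.realize]
  congr 1
  ext i
  split_ifs <;> rfl

theorem realize_iterMul {n : ℕ} (F : Ω.Functions n) {α M : Type*} [Ω.Structure M]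
    (t : Ω.Term α) (x : α → M) (j : ℕ) :
    (iterMul (mulTerm F) t j).realize x = iterMul (mulMap F) (t.realize x) j := by
  induction j with
  | zero => exact realize_mulTerm F t t x
  | succ j ih => rw [iterMul, realize_mulTerm, ih, iterMul]

/-- The first-order sentence that expresses `RootProperty`. -/
def rootSentence {n : ℕ} (F : Ω.Functions n) (j : ℕ) : Ω.Sentence :=
  let x₁ : Ω.Term (Empty ⊕ Fin 1) := .var (.inr 0)
  let x₂ : Ω.Term (Empty ⊕ Fin 2) := .var (.inr 0)
  let y : Ω.Term (Empty ⊕ Fin 2) := .var (.inr 1)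
  let t := iterMul (mulTerm F) x₁ j
  BoundedFormula.ex (n := 0) ((BoundedFormula.all (n := 1)
    ((y.bdEqual x₂) ⊔ ((mulTerm F y x₂).bdEqual x₂))) ⊓
      ((mulTerm F x₁ (mulTerm F t t)).bdEqual x₁))

theorem realize_rootSentence {n : ℕ} (F : Ω.Functions n) (j : ℕ) (M : Type*) [Ω.Structure M] :
    M ⊨ rootSentence F j ↔ RootProperty (mulMap F : M → M → M) j := by
  simp [rootSentence, Sentence.Realize, Formula.Realize, RootProperty, realize_mulTerm,
    realize_iterMul, Fin.snoc]

theorem map_mulMap {n : ℕ} (F : Ω.Functions n) (hn : 2 ≤ n) {M : Type*} [Ω.Structure M]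
    (e : M ↪[Ω] TreeModel b) (x y : M) : e (mulMap F x y) = optMul b (e x) (e y) := by
  rw [mulMap, e.map_fun, funMap_of_two_le hn]
  rfl

/-- The image of `e` is the structure generated by the node `x`. -/
def IsConeEmbedding {M : Type*} [Ω.Structure M] (e : M ↪[Ω] TreeModel b) (x : List ℕ) : Prop :=
  (∀ y : List ℕ, (∃ z, e z = some y) ↔ x <:+ y) ∧ ∀ z, e z = none → Nonempty Ω.Constants

theorem exists_isConeEmbedding_coneModel (x : List ℕ) :
    ∃ e : (coneModel Ω b x : SigModel.{u, v, w} Ω) ↪[Ω] TreeModel b, IsConeEmbedding e x := by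
  refine ⟨(coneSubstructure Ω b x).subtype.comp (coneModelEquiv x).toEmbedding,
    fun y => ⟨?_, fun h => ?_⟩, fun z hz => ?_⟩
  · rintro ⟨z, hz⟩
    rcases ((coneModelEquiv x) z).2 with h | ⟨y', h, hy'⟩
    · exact absurd (hz.symm.trans h.1) (by simp)
    · cases Option.some_injective _ (hz.symm.trans h)
      exact hy'
  · obtain ⟨z, hz⟩ := (coneModelEquiv (Ω := Ω) (b := b) x).surjective ⟨some y, .inr ⟨y, rfl, h⟩⟩
    exact ⟨z, congrArg Subtype.val hz⟩
  · rcases ((coneModelEquiv x) z).2 with h | ⟨y', h, -⟩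
    · exact h.2
    · exact absurd (hz.symm.trans h) (by simp)

/-- A structure embedded in the tree is generated by a node, or consists of the neutral element. -/
theorem isConeEmbedding_or {n : ℕ} (F : Ω.Functions n) (hn : 2 ≤ n) {M : Type*} [Ω.Structure M]
    (e : M ↪[Ω] TreeModel b) (he : ∀ z, e z = none → Nonempty Ω.Constants) :
    (∃ x, IsConeEmbedding e x) ∨ ∀ z, e z = none := by
  by_cases h : ∃ z, ∃ y : List ℕ, e z = some y
  · obtain ⟨z, y, hy⟩ := h
    obtain ⟨x, hx⟩ := exists_cone b (S := {y | ∃ z, e z = some y}) (by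
      rintro y₁ ⟨z₁, h₁⟩ y₂ ⟨z₂, h₂⟩
      exact ⟨mulMap F z₁ z₂, by rw [map_mulMap F hn, h₁, h₂, optMul]⟩) ⟨y, z, hy⟩
    exact .inl ⟨x, hx, he⟩
  · push Not at h
    exact .inr fun z => Option.eq_none_iff_forall_ne_some.2 (h z)

theorem exists_embedding_coneModel {M : Type*} [Ω.Structure M] {e : M ↪[Ω] TreeModel b}
    {x y : List ℕ} (he : IsConeEmbedding e x) (hxy : x <:+ y) :
    Nonempty ((coneModel Ω b y : SigModel.{u, v, w} Ω) ↪[Ω] M) := by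
  have hle : coneSubstructure Ω b y ≤ e.toHom.range := by
    rintro z (⟨rfl, ⟨c⟩⟩ | ⟨y', rfl, hy'⟩)
    · exact ⟨(c : M), e.toHom.map_constants c⟩
    · obtain ⟨z, hz⟩ := (he.1 y').2 (hxy.trans hy')
      exact ⟨z, hz⟩
  exact ⟨e.equivRange.symm.toEmbedding.comp
    ((Substructure.inclusion hle).comp (coneModelEquiv y).toEmbedding)⟩

/-! ### The truth lemma and completeness -/

variable {L : ModelTheoreticLanguage.{u, v, w, s} Ω} {f : L.Sent → L.Sent}

open Classical in
/-- The valuation by which the node `x` satisfies the variables in `t x`, and the neutral element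
those in `k`. -/
noncomputable def treeValuation (L : ModelTheoreticLanguage.{u, v, w, s} Ω) {n : ℕ}
    (F : Ω.Functions n) (k : Set ModalFormula) (j : ℕ) : L.Sent :=
  L.ofFirstOrder (if ModalFormula.var j ∈ k then rootSentence F j else ∼(rootSentence F j))

theorem sat_treeValuation {n : ℕ} (F : Ω.Functions n) (k : Set ModalFormula) (j : ℕ)
    (A : SigModel.{u, v, w} Ω) : L.Sat A (treeValuation L F k j) ↔
      (RootProperty (mulMap F : A → A → A) j ↔ ModalFormula.var j ∈ k) := by
  rw [treeValuation, L.sat_ofFirstOrder]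
  split_ifs with h
  · simp [realize_rootSentence, h]
  · simp [Sentence.realize_not, realize_rootSentence, h]

/-- The labels by which a node is told from the neutral element. -/
def treeLabel (t : List ℕ → Set ModalFormula) (k : Set ModalFormula) (x : List ℕ) (j : ℕ) : Prop :=
  ModalFormula.var j ∈ t x ↔ ModalFormula.var j ∈ k

/-- Both kinds of submodel are treated in one induction, since a cone may have `{none}` as a
submodel. For `◇`, submodels of a cone correspond to nodes above its root, whose worlds are seen, or
to `k`; conversely a witness is found at a child. -/
theorem sat_extend_treeValuation (hf : L.Expresses f Set.univ ContainsSubmodel) {n : ℕ}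
    (F : Ω.Functions n) (hn : 2 ≤ n) {Λ : Set ModalFormula} {t : List ℕ → Set ModalFormula}
    {k : Set ModalFormula} (ht : ∀ x, IsWorld Λ (t x))
    (hsees : ∀ x y, x <:+ y → Sees (t x) (t y))
    (hdia : ∀ x a, dia a ∈ t x → ∃ i, a ∈ t (i :: x))
    (hk : Nonempty Ω.Constants →
      IsWorld Λ k ∧ (∀ a, dia a ∈ k ↔ a ∈ k) ∧ ∀ x, Sees (t x) k) (a : ModalFormula) :
    (∀ (A : SigModel.{u, v, w} Ω) (e : A ↪[Ω] TreeModel (treeLabel t k)) (x : List ℕ),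
      IsConeEmbedding e x → (L.Sat A (L.extend f (treeValuation L F k) a) ↔ a ∈ t x)) ∧
    (Nonempty Ω.Constants →
      ∀ (A : SigModel.{u, v, w} Ω) (e : A ↪[Ω] TreeModel (treeLabel t k)), (∀ z, e z = none) →
        (L.Sat A (L.extend f (treeValuation L F k) a) ↔ a ∈ k)) := by
  induction a with
  | var j =>
    refine ⟨fun A e x he => ?_, fun _ A e he => ?_⟩ <;> rw [extend, sat_treeValuation]
    -- The comparison with `k` occurs both in the label and in the valuation, and cancels.
    · rw [rootProperty_iff e.injective (map_mulMap F hn e) he.1 j, treeLabel]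
      tauto
    · exact iff_true_left
        (rootProperty_of_subsingleton (fun x y => e.injective ((he x).trans (he y).symm)) j)
  | bot =>
    exact ⟨fun A e x _ => iff_of_false not_sat_bot (ht x).bot_notMem,
      fun hc A e _ => iff_of_false not_sat_bot (hk hc).1.bot_notMem⟩
  | imp a b iha ihb =>
    refine ⟨fun A e x he => ?_, fun hc A e he => ?_⟩ <;> rw [sat_extend_imp]
    · rw [(ht x).imp_mem, iha.1 A e x he, ihb.1 A e x he]
    · rw [(hk hc).1.imp_mem, iha.2 hc A e he, ihb.2 hc A e he]
  | dia a ih =>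
    refine ⟨fun A e x he => ?_, fun hc A e he => ?_⟩ <;> rw [sat_extend_dia hf]
    · constructor
      · rintro ⟨B, ⟨e'⟩, hB⟩
        rcases isConeEmbedding_or F hn (e.comp e') fun z hz => he.2 _ hz with ⟨y, hy⟩ | hnone
        · refine hsees x y ?_ _ ((ih.1 B _ y hy).1 hB)
          obtain ⟨z, hz⟩ := (hy.1 y).2 List.suffix_rfl
          exact (he.1 y).1 ⟨e' z, hz⟩
        · obtain ⟨z⟩ := B.nonempty'
          have hc := he.2 (e' z) (hnone z)
          exact (hk hc).2.2 x _ ((ih.2 hc B _ hnone).1 hB)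
      · intro h
        obtain ⟨i, hi⟩ := hdia x a h
        obtain ⟨e', he'⟩ := exists_isConeEmbedding_coneModel (Ω := Ω) (b := treeLabel t k) (i :: x)
        exact ⟨_, exists_embedding_coneModel he (List.suffix_cons i x),
          (ih.1 _ e' _ he').2 hi⟩
    · rw [(hk hc).2.1]
      constructor
      · rintro ⟨B, ⟨e'⟩, hB⟩
        exact (ih.2 hc B (e.comp e') fun z => he _).1 hB
      · exact fun h => ⟨A, ⟨Embedding.refl Ω A⟩, (ih.2 hc A e he).2 h⟩

/-- A world of a logic that includes `S4` includes the modal theory of the submodel relation, provided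
that it has a final world if there are constants. -/
theorem mem_of_mem_modalTheory (hf : L.Expresses f Set.univ ContainsSubmodel)
    (hΩ : ∃ n : ℕ, 2 ≤ n ∧ Nonempty (Ω.Functions n)) {Λ m k : Set ModalFormula}
    (hΛ : IsS4Logic Λ) (hm : IsWorld Λ m)
    (hk : Nonempty Ω.Constants → IsWorld Λ k ∧ (∀ a, dia a ∈ k ↔ a ∈ k) ∧
      ∀ n, IsWorld Λ n → Sees m n → Sees n k)
    {a : ModalFormula} (ha : a ∈ L.modalTheory (L.theoryOf Set.univ) f) : a ∈ m := by
  obtain ⟨n, hn, ⟨F⟩⟩ := hΩ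
  obtain ⟨t, ht₀, ht, hsees, hdia⟩ := hm.exists_tree hΛ
  obtain ⟨e, he⟩ := exists_isConeEmbedding_coneModel (Ω := Ω) (b := treeLabel t k) []
  have := (sat_extend_treeValuation hf F hn ht hsees hdia (fun hc => ⟨(hk hc).1, (hk hc).2.1,
    fun x => (hk hc).2.2 _ (ht x) (ht₀ ▸ hsees [] x x.nil_suffix)⟩) a).1 _ e [] he
  exact ht₀ ▸ this.1 (mem_modalTheory.1 ha _ _)

end ModelTheoreticLanguage

open ModelTheoreticLanguage

theorem mainTheorem1
    (Ω : FirstOrder.Language.{u, v})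
    (hΩ : ∃ n : ℕ, 2 ≤ n ∧ Nonempty (Ω.Functions n))
    (L : ModelTheoreticLanguage.{u, v, w, s} Ω)
    (f : L.Sent → L.Sent)
    (hf : L.Expresses f Set.univ ContainsSubmodel) :
    (IsEmpty Ω.Constants → L.modalTheory (L.theoryOf Set.univ) f = logicS4) ∧
    (Nonempty Ω.Constants → L.modalTheory (L.theoryOf Set.univ) f = logicS421) := by
  have hS4 := modalTheory_isS4Logic hf
  constructor
  · intro hc
    refine Set.Subset.antisymm (fun a ha => ?_) (leastNormalLogic_subset hS4.1 ?_)
    · by_contra hna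
      obtain ⟨m, hm, ham⟩ := exists_isWorld_of_notMem logicS4_isS4Logic.1 hna
      -- The set `∅` is a dummy: without constants nothing is required of `k`.
      exact ham (mem_of_mem_modalTheory (k := ∅) hf hΩ logicS4_isS4Logic hm
        (fun h => (not_nonempty_iff.2 hc h).elim) ha)
    · rintro a (rfl | rfl)
      exacts [hS4.trans _, hS4.refl _]
  · intro hc
    refine Set.Subset.antisymm (fun a ha => ?_) (logicS421_subset_modalTheory hf)
    by_contra hna
    obtain ⟨m, hm, ham⟩ := exists_isWorld_of_notMem logicS421_isS4Logic.1 hna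
    exact ham (mem_of_mem_modalTheory hf hΩ logicS421_isS4Logic hm
      (fun _ => ⟨hm.finalWorld_isWorld, fun _ => hm.dia_mem_finalWorld,
        fun _ => hm.sees_finalWorld⟩) ha)
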